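/- Conventions: $x^y=y^{-1}xy$ and $[x,y]=x^{-1}y^{-1}xy$. Let $q\ge 0$ be an integer and $G$ a group. The $q$-tensor square $G\otimes^q G$ is the group generated by symbols $g\otimes h$ and, if $q\ge 1$, symbols $\widehat k$ ($g,h,k\in G$), subject to the relations, for all $g,g_1,h,h_1,k,k_1\in G$, $$g\otimes hh_1=(g\otimes h_1)(g^{h_1}\otimes h^{h_1}),\qquad gg_1\otimes h=(g^{g_1}\otimes h^{g_1})(g_1\otimes h),$$ and, if $q\ge1$, $$(g\otimes h)^{\widehat k}=g^{k^q}\otimes h^{k^q},\qquad \widehat{kk_1}=\widehat k\ \prod_{i=1}^{q-1}\bigl(k\otimes (k_1^{-i})^{k^{q-1-i}}\bigr)\ \widehat{k_1},$$ $$[\widehat k,\widehat{k_1}]=k^q\otimes k_1^q,\qquad \widehat{[g,h]}=(g\otimes h)^q,$$ where the factors of the product are written in the order $i=1,\dots,q-1$. The $q$-exterior square $G\wedge^q G$ is the quotient of $G\otimes^q G$ by the (central) subgroup generated by all $g\otimes g$; the image of $g\otimes h$ is written $g\wedge h$. The $q$-exterior centre of $G$ is $$Z_q^\wedge(G)=\{g\in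 G : g\wedge x=1 \text{ in } G\wedge^q G \text{ for all } x\in G\}.$$ The group $G$ is $q$-capable if there is a group $Q$ with $G\cong Q/Z(Q)$ in which every $z\in Z(Q)$ satisfies $z^q=1$. Theorem. Let $q\ge 0$ be an integer, let $G$ be a polycyclic group, and let $G\cong F_n/R$ be a presentation of $G$, where $F_n$ is the free group on $n$ generators (for instance a consistent polycyclic presentation). Let $R^q$ be the subgroup generated by the $q$-th powers of the elements of $R$, put $E_q(G)=F_n/R^q[F_n,R]$, and let $\pi:E_q(G)\to G$ be the natural epimorphism. Then $$Z_q^\wedge(G)=\pi\bigl(Z(E_q(G))\bigr).$$ Moreover, $G$ is $q$-capable if and only if $\pi\bigl(Z(E_q(G))\bigr)=1$. -/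

import Mathlib

namespace QExterior

/-- `G` is polycyclic: there is a finite series `1 = H 0 ≤ H 1 ≤ ⋯ ≤ H m = G` of subgroups,
each normal in the next one, with cyclic factors `H (i + 1) / H i`. -/
def IsPolycyclic (G : Type*) [Group G] : Prop :=
  ∃ (m : ℕ) (H : ℕ → Subgroup G), H 0 = ⊥ ∧ H m = ⊤ ∧
    ∀ i < m, H i ≤ H (i + 1) ∧
      ∃ _ : ((H i).subgroupOf (H (i + 1))).Normal,
        IsCyclic (H (i + 1) ⧸ (H i).subgroupOf (H (i + 1)))

/-- The conjugate `x ^ y = y⁻¹ x y`. -/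
def conj {G : Type*} [Group G] (x y : G) : G := y⁻¹ * x * y

/-- The commutator `[x, y] = x⁻¹ y⁻¹ x y`. -/
def comm {G : Type*} [Group G] (x y : G) : G := x⁻¹ * y⁻¹ * x * y

/-! ### The `q`-tensor square and the `q`-exterior square -/

/-- The generating symbols of the `q`-tensor square of `G`: the symbols `g ⊗ h` and, if `q ≥ 1`,
the symbols `k̂`. For `q = 0` there are no symbols `k̂`. -/
inductive TensorGen (q : ℕ) (G : Type*) : Type _
  | tmul (g h : G) : TensorGen q G
  | hat (hq : 1 ≤ q) (k : G) : TensorGen q G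

/-- The symbol `g ⊗ h` in the free group on the generating symbols. -/
def tm (q : ℕ) {G : Type*} (g h : G) : FreeGroup (TensorGen q G) :=
  FreeGroup.of (TensorGen.tmul g h)

/-- The symbol `k̂` in the free group on the generating symbols (`q ≥ 1`). -/
def ht {q : ℕ} (hq : 1 ≤ q) {G : Type*} (k : G) : FreeGroup (TensorGen q G) :=
  FreeGroup.of (TensorGen.hat hq k)

/-- The defining relations `l = r` of the `q`-tensor square. In `hat_mul` the product runs over
`i = j + 1 = 1, …, q - 1` in this order, and `(k ⊗ k₁⁻ⁱ) ^ x` stands for `kˣ ⊗ (k₁⁻ⁱ)ˣ`, where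
`x = k ^ (q - 1 - i)`. -/
inductive TensorRel (q : ℕ) (G : Type*) [Group G] :
    FreeGroup (TensorGen q G) → FreeGroup (TensorGen q G) → Prop
  | tmul_mul (g h h₁ : G) :
      TensorRel q G (tm q g (h * h₁)) (tm q g h₁ * tm q (conj g h₁) (conj h h₁))
  | mul_tmul (g g₁ h : G) :
      TensorRel q G (tm q (g * g₁) h) (tm q (conj g g₁) (conj h g₁) * tm q g₁ h)
  | conj_hat (hq : 1 ≤ q) (g h k : G) :
      TensorRel q G (conj (tm q g h) (ht hq k)) (tm q (conj g (k ^ q)) (conj h (k ^ q)))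
  | hat_mul (hq : 1 ≤ q) (k k₁ : G) :
      TensorRel q G (ht hq (k * k₁))
        (ht hq k *
          ((List.range (q - 1)).map fun j =>
            tm q (conj k (k ^ (q - 1 - (j + 1))))
              (conj (k₁ ^ (j + 1))⁻¹ (k ^ (q - 1 - (j + 1))))).prod *
          ht hq k₁)
  | comm_hat (hq : 1 ≤ q) (k k₁ : G) :
      TensorRel q G (comm (ht hq k) (ht hq k₁)) (tm q (k ^ q) (k₁ ^ q))
  | hat_comm (hq : 1 ≤ q) (g h : G) :
      TensorRel q G (ht hq (comm g h)) (tm q g h ^ q)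

/-- The `q`-tensor square `G ⊗^q G`. For `q = 0` it is the non-abelian tensor square. -/
abbrev TensorSquare (q : ℕ) (G : Type*) [Group G] : Type _ :=
  PresentedGroup {w : FreeGroup (TensorGen q G) | ∃ l r, TensorRel q G l r ∧ w = l * r⁻¹}

/-- The element `g ⊗ h` of `G ⊗^q G`. -/
def tmul (q : ℕ) {G : Type*} [Group G] (g h : G) : TensorSquare q G :=
  PresentedGroup.of (TensorGen.tmul g h)

/-- The element `k̂` of `G ⊗^q G` (`q ≥ 1`). -/
def hat {q : ℕ} (hq : 1 ≤ q) {G : Type*} [Group G] (k : G) : TensorSquare q G :=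
  PresentedGroup.of (TensorGen.hat hq k)

/-- The diagonal subgroup `∇^q(G)` of `G ⊗^q G`, generated by all `g ⊗ g`. -/
def diagonal (q : ℕ) (G : Type*) [Group G] : Subgroup (TensorSquare q G) :=
  Subgroup.closure (Set.range fun g : G => tmul q g g)

section lemmas

variable {q : ℕ} {G : Type*} [Group G]

theorem mk_eq_of_rel {l r : FreeGroup (TensorGen q G)} (h : TensorRel q G l r) :
    (PresentedGroup.mk _ l : TensorSquare q G) = PresentedGroup.mk _ r :=
  PresentedGroup.mk_eq_mk_of_mul_inv_mem ⟨l, r, h, rfl⟩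

theorem tmul_mul (g h h₁ : G) :
    tmul q g (h * h₁) = tmul q g h₁ * tmul q (conj g h₁) (conj h h₁) :=
  mk_eq_of_rel (TensorRel.tmul_mul g h h₁)

theorem mul_tmul (g g₁ h : G) :
    tmul q (g * g₁) h = tmul q (conj g g₁) (conj h g₁) * tmul q g₁ h :=
  mk_eq_of_rel (TensorRel.mul_tmul g g₁ h)

theorem conj_hat (hq : 1 ≤ q) (g h k : G) :
    conj (tmul q g h) (hat hq k) = tmul q (conj g (k ^ q)) (conj h (k ^ q)) :=
  mk_eq_of_rel (TensorRel.conj_hat hq g h k)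

theorem conj_mul (x y z : G) : conj (x * y) z = conj x z * conj y z := by
  simp only [conj]; group

theorem conj_conj (x y z : G) : conj (conj x y) z = conj x (y * z) := by
  simp only [conj]; group

/-- Conjugation by `g₁ ⊗ h₁` is the diagonal action of `[g₁, h₁]`. -/
theorem conj_tmul (g h g₁ h₁ : G) :
    conj (tmul q g h) (tmul q g₁ h₁) =
      tmul q (conj g (comm g₁ h₁)) (conj h (comm g₁ h₁)) := by
  have key : ∀ a b : G, tmul q g₁ h₁ * tmul q (conj a (g₁ * h₁)) (conj b (g₁ * h₁)) =
      tmul q (conj a (h₁ * g₁)) (conj b (h₁ * g₁)) * tmul q g₁ h₁ := by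
    intro a b
    have e₁ : tmul q (a * g₁) (b * h₁) = tmul q (conj a g₁) (conj h₁ g₁) * (tmul q g₁ h₁ *
        tmul q (conj a (g₁ * h₁)) (conj b (g₁ * h₁))) * tmul q (conj g₁ h₁) (conj b h₁) := by
      have e : g₁ * h₁ = h₁ * conj g₁ h₁ := by simp only [conj]; group
      rw [tmul_mul, mul_tmul, conj_mul, mul_tmul, conj_conj, conj_conj, ← e]
      simp only [mul_assoc]
    have e₂ : tmul q (a * g₁) (b * h₁) = tmul q (conj a g₁) (conj h₁ g₁) *
        (tmul q (conj a (h₁ * g₁)) (conj b (h₁ * g₁)) * tmul q g₁ h₁) *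
        tmul q (conj g₁ h₁) (conj b h₁) := by
      have e : h₁ * g₁ = g₁ * conj h₁ g₁ := by simp only [conj]; group
      rw [mul_tmul, tmul_mul g₁, conj_mul, tmul_mul, conj_conj, conj_conj, ← e]
      simp only [mul_assoc]
    exact mul_left_cancel (mul_right_cancel (e₁.symm.trans e₂))
  have h₀ := key (conj g (h₁ * g₁)⁻¹) (conj h (h₁ * g₁)⁻¹)
  have e₃ : (h₁ * g₁)⁻¹ * (g₁ * h₁) = comm g₁ h₁ := by simp only [comm]; group
  have e₄ : ∀ x : G, conj x 1 = x := by intro x; simp [conj]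
  rw [conj_conj, conj_conj, conj_conj, conj_conj, e₃, inv_mul_cancel, e₄, e₄] at h₀
  rw [conj, mul_assoc, ← h₀, inv_mul_cancel_left]

theorem exists_conj_tmul_eq (t : TensorSquare q G) :
    ∃ x : G, ∀ g h : G, conj (tmul q g h) t = tmul q (conj g x) (conj h x) := by
  have ht : t ∈ Subgroup.closure (Set.range (PresentedGroup.of : TensorGen q G →
      TensorSquare q G)) := by
    rw [PresentedGroup.closure_range_of]; trivial
  induction ht using Subgroup.closure_induction with
  | mem t ht =>
    obtain ⟨s, rfl⟩ := ht
    cases s with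
    | tmul g₁ h₁ => exact ⟨comm g₁ h₁, fun g h => conj_tmul g h g₁ h₁⟩
    | hat hq k => exact ⟨k ^ q, fun g h => conj_hat hq g h k⟩
  | one => exact ⟨1, fun g h => by simp [conj]⟩
  | mul s t _ _ hs ht =>
    obtain ⟨x, hx⟩ := hs
    obtain ⟨y, hy⟩ := ht
    exact ⟨x * y, fun g h => by rw [← conj_conj, hx, hy, conj_conj, conj_conj]⟩
  | inv t _ ht =>
    obtain ⟨x, hx⟩ := ht
    refine ⟨x⁻¹, fun g h => ?_⟩
    have h₀ := hx (conj g x⁻¹) (conj h x⁻¹)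
    rw [conj_conj, conj_conj, inv_mul_cancel] at h₀
    simp only [conj, inv_one, one_mul, mul_one] at h₀ ⊢
    rw [← h₀]; group

instance diagonal_normal : (diagonal q G).Normal := by
  refine ⟨fun d hd t => ?_⟩
  obtain ⟨x, hx⟩ := exists_conj_tmul_eq (q := q) (G := G) t⁻¹
  unfold diagonal at hd ⊢
  induction hd using Subgroup.closure_induction with
  | mem d hd =>
    obtain ⟨g, rfl⟩ := hd
    have h := hx g g
    rw [conj, inv_inv] at h
    exact h ▸ Subgroup.subset_closure ⟨conj g x, rfl⟩
  | one => simp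
  | mul a b _ _ ha hb =>
    have e : t * (a * b) * t⁻¹ = (t * a * t⁻¹) * (t * b * t⁻¹) := by group
    exact e ▸ mul_mem ha hb
  | inv a _ ha =>
    have e : t * a⁻¹ * t⁻¹ = (t * a * t⁻¹)⁻¹ := by group
    exact e ▸ inv_mem ha

end lemmas

/-- The `q`-exterior square `G ∧^q G = (G ⊗^q G) / ∇^q(G)`. -/
abbrev ExteriorSquare (q : ℕ) (G : Type*) [Group G] : Type _ :=
  TensorSquare q G ⧸ diagonal q G

/-- The element `g ∧ h` of `G ∧^q G`, the image of `g ⊗ h`. -/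
def wedge (q : ℕ) {G : Type*} [Group G] (g h : G) : ExteriorSquare q G :=
  QuotientGroup.mk (tmul q g h)

section lemmas

variable {q : ℕ} {G : Type*} [Group G]

theorem wedge_mul (g h h₁ : G) :
    wedge q g (h * h₁) = wedge q g h₁ * wedge q (conj g h₁) (conj h h₁) := by
  simp only [wedge, tmul_mul, QuotientGroup.mk_mul]

theorem mul_wedge (g g₁ h : G) :
    wedge q (g * g₁) h = wedge q (conj g g₁) (conj h g₁) * wedge q g₁ h := by
  simp only [wedge, mul_tmul, QuotientGroup.mk_mul]

theorem wedge_conj_of_forall {g : G} (hg : ∀ x : G, wedge q g x = 1) (x y : G) :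
    wedge q (conj g y) (conj x y) = 1 := by
  have h := wedge_mul (q := q) g x y
  rw [hg, hg, one_mul] at h
  exact h.symm

theorem one_wedge (h : G) : wedge q (1 : G) h = 1 := by
  have e := mul_wedge (q := q) (1 : G) 1 h
  simpa [conj] using e

end lemmas

/-- The `q`-exterior centre `Z_q^∧(G)`: all `g` with `g ∧ x = 1` in `G ∧^q G` for all `x`. -/
def exteriorCenter (q : ℕ) (G : Type*) [Group G] : Subgroup G where
  carrier := {g | ∀ x : G, wedge q g x = 1}
  one_mem' := fun x => one_wedge x
  mul_mem' := by
    intro a b ha hb x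
    rw [mul_wedge, hb x, wedge_conj_of_forall ha, one_mul]
  inv_mem' := by
    intro a ha x
    have h := mul_wedge (q := q) a a⁻¹ x
    rwa [mul_inv_cancel, one_wedge, wedge_conj_of_forall ha, one_mul, eq_comm] at h

/-! ### The group `E_q(G)` -/

/-- `R^q`, the subgroup generated by the `q`-th powers of the elements of `R`. -/
def powerSubgroup {F : Type*} [Group F] (R : Subgroup F) (q : ℕ) : Subgroup F :=
  Subgroup.closure ((fun r => r ^ q) '' (R : Set F))

instance powerSubgroup_normal {F : Type*} [Group F] (R : Subgroup F) [hR : R.Normal] (q : ℕ) :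
    (powerSubgroup R q).Normal := by
  refine ⟨fun d hd t => ?_⟩
  unfold powerSubgroup at hd ⊢
  induction hd using Subgroup.closure_induction with
  | mem d hd =>
    obtain ⟨r, hr, rfl⟩ := hd
    exact Subgroup.subset_closure ⟨t * r * t⁻¹, hR.conj_mem r hr t, conj_pow⟩
  | one => simp
  | mul a b _ _ ha hb =>
    have e : t * (a * b) * t⁻¹ = (t * a * t⁻¹) * (t * b * t⁻¹) := by group
    exact e ▸ mul_mem ha hb
  | inv a _ ha =>
    have e : t * a⁻¹ * t⁻¹ = (t * a * t⁻¹)⁻¹ := by group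
    exact e ▸ inv_mem ha

/-- For `φ : F →* G` with kernel `R`, the subgroup `R^q [F, R]` of `F`. -/
def relSubgroup {F G : Type*} [Group F] [Group G] (φ : F →* G) (q : ℕ) : Subgroup F :=
  powerSubgroup φ.ker q ⊔ ⁅(⊤ : Subgroup F), φ.ker⁆

instance relSubgroup_normal {F G : Type*} [Group F] [Group G] (φ : F →* G) (q : ℕ) :
    (relSubgroup φ q).Normal := by
  unfold relSubgroup; infer_instance

theorem relSubgroup_le_ker {F G : Type*} [Group F] [Group G] (φ : F →* G) (q : ℕ) :
    relSubgroup φ q ≤ φ.ker := by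
  refine sup_le ((Subgroup.closure_le _).mpr ?_) (Subgroup.commutator_le_right _ _)
  rintro _ ⟨r, hr, rfl⟩
  exact pow_mem hr q

/-- For a free presentation `φ : F →* G` of `G` (`F` free, `φ` onto) with kernel `R`, the group
`E_q(G) = F / R^q [F, R]`. -/
abbrev E {F G : Type*} [Group F] [Group G] (φ : F →* G) (q : ℕ) : Type _ :=
  F ⧸ relSubgroup φ q

/-- The natural map `π : E_q(G) → G` induced by `φ`. -/
def E.proj {F G : Type*} [Group F] [Group G] (φ : F →* G) (q : ℕ) : E φ q →* G :=
  QuotientGroup.lift (relSubgroup φ q) φ (relSubgroup_le_ker φ q)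

/-! ### Capability -/

/-- The `q`-centre `Z_q(Q)`: the central elements of order dividing `q` (all central elements
if `q = 0`). -/
def qCenter (q : ℕ) (Q : Type*) [Group Q] : Subgroup Q where
  carrier := {z | z ∈ Subgroup.center Q ∧ z ^ q = 1}
  one_mem' := ⟨one_mem _, one_pow q⟩
  mul_mem' := by
    rintro a b ⟨ha, ha'⟩ ⟨hb, hb'⟩
    have hab : Commute a b := (Subgroup.mem_center_iff.mp ha b).symm
    exact ⟨mul_mem ha hb, by rw [hab.mul_pow, ha', hb', one_mul]⟩
  inv_mem' := by
    rintro a ⟨ha, ha'⟩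
    exact ⟨inv_mem ha, by rw [inv_pow, ha', inv_one]⟩

/-- `G` is `q`-capable: `G ≅ Q / Z(Q)` for some group `Q` with `Z(Q) = Z_q(Q)`. -/
def IsQCapable.{u} (q : ℕ) (G : Type u) [Group G] : Prop :=
  ∃ (Q : Type u) (_ : Group Q),
    Subgroup.center Q = qCenter q Q ∧ Nonempty (G ≃* Q ⧸ Subgroup.center Q)

end QExterior

/-! Write `R` for the kernel of `φ`, `∂` for the map `boundary` and `k̂` for `extHat hq k`. The
kernel of `E φ q → G` is central of exponent dividing `q`, so commutators and `q`-th powers in `E φ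
q` depend only on images in `G`. They therefore satisfy the relations of `G ∧^q G`, and
`exists_lift` sends `g ∧ h` to the commutator of any two lifts. An element of the exterior centre
thus has central lifts.

The converse, `wedge_eq_one_of_comm_mem`, needs enough room to detect `g ∧ h`. A `WedgeExtension` is
a group `Q` over `G` containing `G ∧^q G`, in which `[a, b] = da ∧ db` and no element outside `G ∧^q
G` has a nonzero power inside it. The group `G ∧^q G` is itself one (`comm_eq_wedge_boundary`), and
semidirect products with `ℤ` adjoin lifts of the generators of `G` one at a time. Then `φ` lifts to
`s : F → Q`. The kernel of `d` is central, so `s` maps `R^q [F, R]` to `q`-th powers of elements of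
`s(R)`. If `[a, b]` lies in that subgroup, `φ a ∧ φ b = s(r)^q` with `r ∈ R`. For `q = 0` this is
`1`. Otherwise `s(r)` is some `p ∈ G ∧^q G` with `∂p = 1`, and `p^q` is the hat of `∂p`
(`extHat_boundary`), hence trivial.

For capability, a map from `F` to a witness `Q` kills `R^q [F, R]` and carries lifts of central
elements of `E φ q` into `Z(Q)`; conversely, if `π(Z(E)) = 1`, then `E φ q` is itself a witness. -/

namespace QExterior

/-! ### Commutator and power identities -/

section identities

variable {Y : Type*} [Group Y]

theorem conj_one (x : Y) : conj x 1 = x := by simp [conj]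

theorem one_conj (x : Y) : conj 1 x = 1 := by simp [conj]

theorem conj_conj_inv (x y : Y) : conj (conj x y⁻¹) y = x := by
  simp only [conj]; group

theorem comm_mul_left (a b c : Y) : comm (a * b) c = conj (comm a c) b * comm b c := by
  simp only [conj, comm]; group

theorem comm_mul_right (a b c : Y) : comm a (b * c) = comm a c * conj (comm a b) c := by
  simp only [conj, comm]; group

theorem comm_inv (a b : Y) : (comm a b)⁻¹ = comm b a := by
  simp only [comm]; group

theorem conj_comm (a b c : Y) : conj (comm a b) c = comm (conj a c) (conj b c) := by
  simp only [conj, comm]; group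

theorem conj_eq_mul_comm (a b : Y) : conj a b = a * comm a b := by
  simp only [conj, comm]; group

theorem comm_eq_one_iff (a b : Y) : comm a b = 1 ↔ a * b = b * a := by
  rw [comm, mul_assoc, mul_eq_one_iff_inv_eq, mul_inv_rev, inv_inv, inv_inv, eq_comm]

theorem map_conj {Z : Type*} [Group Z] (f : Y →* Z) (a b : Y) :
    f (conj a b) = conj (f a) (f b) := by
  simp [conj]

theorem map_comm {Z : Type*} [Group Z] (f : Y →* Z) (a b : Y) :
    f (comm a b) = comm (f a) (f b) := by
  simp [comm]

theorem comm_mul_of_mem_center (a b : Y) {z w : Y} (hz : z ∈ Subgroup.center Y)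
    (hw : w ∈ Subgroup.center Y) : comm (a * z) (b * w) = comm a b := by
  have e₁ : ∀ c, comm z c = 1 := fun c =>
    (comm_eq_one_iff z c).mpr (Subgroup.mem_center_iff.mp hz c).symm
  have e₂ : ∀ c, comm c w = 1 := fun c =>
    (comm_eq_one_iff c w).mpr (Subgroup.mem_center_iff.mp hw c)
  have e₃ : ∀ c, conj c z = c := fun c => by rw [conj_eq_mul_comm, ← comm_inv, e₁]; simp
  have e₄ : ∀ c, conj c w = c := fun c => by rw [conj_eq_mul_comm, e₂]; simp
  rw [comm_mul_left, e₁, mul_one, e₃, comm_mul_right, e₂, one_mul, e₄]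

theorem prod_map_range_inv_mul (B : ℕ → Y) (m : ℕ) :
    ((List.range m).map fun j => (B j)⁻¹ * B (j + 1)).prod = (B 0)⁻¹ * B m := by
  induction m with
  | zero => simp
  | succ m ih => simp [List.range_succ, ih, mul_assoc]

/-- The expansion of `(a b) ^ q` which underlies the relation for `k̂k₁`. -/
theorem mul_pow_eq_prod_comm {q : ℕ} (hq : 1 ≤ q) (a b : Y) :
    (a * b) ^ q = a ^ q *
      ((List.range (q - 1)).map fun j =>
        conj (comm a (b ^ (j + 1))⁻¹) (a ^ (q - 1 - (j + 1)))).prod * b ^ q := by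
  obtain ⟨m, rfl⟩ : ∃ m, q = m + 1 := ⟨q - 1, by omega⟩
  -- The product telescopes: with `m = q - 1` and `B j = (b a)^j b^(-j) a^(m - j)`, the factor at
  -- index `j` is `(B j)⁻¹ * B (j + 1)`.
  have e : ((List.range m).map fun j =>
      conj (comm a (b ^ (j + 1))⁻¹) (a ^ (m - (j + 1)))) =
      (List.range m).map fun j => ((b * a) ^ j * (b ^ j)⁻¹ * a ^ (m - j))⁻¹ *
        ((b * a) ^ (j + 1) * (b ^ (j + 1))⁻¹ * a ^ (m - (j + 1))) := by
    refine List.map_congr_left fun j hj => ?_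
    obtain ⟨k, rfl⟩ : ∃ k, m = j + 1 + k := ⟨m - (j + 1), by
      have := List.mem_range.mp hj; omega⟩
    have e₁ : j + 1 + k - j = k + 1 := by omega
    have e₂ : j + 1 + k - (j + 1) = k := by omega
    rw [e₁, e₂, pow_succ (b * a), pow_succ' a k, pow_succ b]
    simp only [conj, comm]
    generalize (b * a) ^ j = u
    generalize b ^ j = v
    generalize a ^ k = w
    group
  rw [Nat.add_sub_cancel, e,
    prod_map_range_inv_mul fun j => (b * a) ^ j * (b ^ j)⁻¹ * a ^ (m - j)]
  rw [pow_succ (a * b), ← mul_assoc, mul_pow_mul, pow_succ a, pow_succ b]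
  simp only [pow_zero, Nat.sub_self, Nat.sub_zero]
  group

end identities

/-! ### Homomorphisms out of the exterior square -/

section lift

variable {q : ℕ} {G : Type*} [Group G]

/-- The element `k̂` of `G ∧^q G`. -/
def extHat (hq : 1 ≤ q) (k : G) : ExteriorSquare q G :=
  QuotientGroup.mk (hat hq k)

theorem exteriorSquare_closure_eq_top (S : Subgroup (ExteriorSquare q G))
    (hw : ∀ g h : G, wedge q g h ∈ S) (hh : ∀ (hq : 1 ≤ q) (k : G), extHat hq k ∈ S) :
    S = ⊤ := by
  have e : S.comap (QuotientGroup.mk' (diagonal q G)) = ⊤ := by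
    rw [eq_top_iff, ← PresentedGroup.closure_range_of, Subgroup.closure_le]
    rintro _ ⟨s, rfl⟩
    cases s with
    | tmul g h => exact hw g h
    | hat hq k => exact hh hq k
  rw [eq_top_iff]
  intro p _
  obtain ⟨t, rfl⟩ := QuotientGroup.mk'_surjective _ p
  have : t ∈ S.comap (QuotientGroup.mk' (diagonal q G)) := e ▸ Subgroup.mem_top t
  exact this

/-- An extension `pr : Y → G` with central kernel of exponent dividing `q` receives the
`q`-exterior square of `G`. -/
theorem exists_lift {Y : Type*} [Group Y] (pr : Y →* G) (hpr : Function.Surjective pr)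
    (hc : pr.ker ≤ qCenter q Y) :
    ∃ Ψ : ExteriorSquare q G →* Y, (∀ a b, Ψ (wedge q (pr a) (pr b)) = comm a b) ∧
      ∀ (hq : 1 ≤ q) (a : Y), Ψ (extHat hq (pr a)) = a ^ q := by
  obtain ⟨s, hs⟩ := hpr.hasRightInverse
  have hs' : ∀ a, ∃ z ∈ qCenter q Y, s (pr a) = a * z := fun a =>
    ⟨a⁻¹ * s (pr a), hc (by rw [MonoidHom.mem_ker, map_mul, hs, map_inv, inv_mul_cancel]),
      by group⟩
  have hcomm : ∀ a b, comm (s (pr a)) (s (pr b)) = comm a b := by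
    intro a b
    obtain ⟨z, hz, ea⟩ := hs' a
    obtain ⟨w, hw, eb⟩ := hs' b
    rw [ea, eb, comm_mul_of_mem_center a b hz.1 hw.1]
  have hpow : ∀ a, s (pr a) ^ q = a ^ q := by
    intro a
    obtain ⟨z, hz, ea⟩ := hs' a
    have : Commute a z := Subgroup.mem_center_iff.mp hz.1 a
    rw [ea, this.mul_pow, hz.2, mul_one]
  let f : TensorGen q G → Y
    | .tmul g h => comm (s g) (s h)
    | .hat _ k => s k ^ q
  have ft : ∀ a b, FreeGroup.lift f (tm q (pr a) (pr b)) = comm a b := by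
    intro a b; simp [tm, f, hcomm]
  have fh : ∀ hq a, FreeGroup.lift f (ht hq (pr a)) = a ^ q := by
    intro hq a; simp [ht, f, hpow]
  have hrel : ∀ l r, TensorRel q G l r → FreeGroup.lift f l = FreeGroup.lift f r := by
    intro l r h
    induction h with
    | tmul_mul g h h₁ =>
      obtain ⟨g, rfl⟩ := hpr g
      obtain ⟨h, rfl⟩ := hpr h
      obtain ⟨h₁, rfl⟩ := hpr h₁
      simp only [← map_conj, ← map_mul pr, map_mul (FreeGroup.lift f), ft, comm_mul_right, conj_comm]
    | mul_tmul g g₁ h =>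
      obtain ⟨g, rfl⟩ := hpr g
      obtain ⟨h, rfl⟩ := hpr h
      obtain ⟨g₁, rfl⟩ := hpr g₁
      simp only [← map_conj, ← map_mul pr, map_mul (FreeGroup.lift f), ft, comm_mul_left, conj_comm]
    | conj_hat hq g h k =>
      obtain ⟨g, rfl⟩ := hpr g
      obtain ⟨h, rfl⟩ := hpr h
      obtain ⟨k, rfl⟩ := hpr k
      rw [map_conj, ft, fh, ← map_pow, ← map_conj, ← map_conj, ft, conj_comm]
    | hat_mul hq k k₁ =>
      obtain ⟨k, rfl⟩ := hpr k
      obtain ⟨k₁, rfl⟩ := hpr k₁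
      rw [map_mul, map_mul, map_list_prod, List.map_map, ← map_mul, fh, fh, fh,
        mul_pow_eq_prod_comm hq]
      congr 3
      refine List.map_congr_left fun j _ => ?_
      simp only [Function.comp_apply, ← map_pow, ← map_inv, ← map_conj, ft, conj_comm]
    | comm_hat hq k k₁ =>
      obtain ⟨k, rfl⟩ := hpr k
      obtain ⟨k₁, rfl⟩ := hpr k₁
      rw [map_comm, fh, fh, ← map_pow, ← map_pow, ft]
    | hat_comm hq g h =>
      obtain ⟨g, rfl⟩ := hpr g
      obtain ⟨h, rfl⟩ := hpr h
      rw [map_pow, ft, ← map_comm, fh]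
  let T : TensorSquare q G →* Y := PresentedGroup.toGroup (f := f) (by
    rintro _ ⟨l, r, h, rfl⟩
    rw [map_mul, map_inv, hrel l r h, mul_inv_cancel])
  have hT : diagonal q G ≤ T.ker := by
    rw [diagonal, Subgroup.closure_le]
    rintro _ ⟨g, rfl⟩
    change T (PresentedGroup.of _) = 1
    rw [PresentedGroup.toGroup.of]
    exact (comm_eq_one_iff _ _).mpr rfl
  refine ⟨QuotientGroup.lift (diagonal q G) T hT, fun a b => ?_, fun hq a => ?_⟩
  · exact Eq.trans (b := f (.tmul (pr a) (pr b))) (FreeGroup.lift_apply_of ..) (hcomm a b)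
  · exact Eq.trans (b := f (.hat hq (pr a))) (FreeGroup.lift_apply_of ..) (hpow a)

variable (q G) in
/-- The homomorphism `G ∧^q G → G` with `g ∧ h ↦ [g, h]` and `k̂ ↦ k ^ q`. -/
theorem exists_boundary : ∃ Ψ : ExteriorSquare q G →* G,
    (∀ a b, Ψ (wedge q a b) = comm a b) ∧ ∀ (hq : 1 ≤ q) (a : G), Ψ (extHat hq a) = a ^ q :=
  exists_lift (MonoidHom.id G) Function.surjective_id (by
    intro z hz
    rw [show z = 1 from hz]
    exact one_mem _)

variable (q G) in
/-- The homomorphism `G ∧^q G → G` with `g ∧ h ↦ [g, h]` and `k̂ ↦ k ^ q`. -/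
noncomputable def boundary : ExteriorSquare q G →* G := (exists_boundary q G).choose

theorem boundary_wedge (g h : G) : boundary q G (wedge q g h) = comm g h :=
  (exists_boundary q G).choose_spec.1 g h

theorem boundary_extHat (hq : 1 ≤ q) (k : G) : boundary q G (extHat hq k) = k ^ q :=
  (exists_boundary q G).choose_spec.2 hq k

end lift

/-! ### Calculus in the exterior square -/

section wedge

variable {q : ℕ} {G : Type*} [Group G]

theorem wedge_self (g : G) : wedge q g g = 1 :=
  (QuotientGroup.eq_one_iff _).mpr (Subgroup.subset_closure ⟨g, rfl⟩)

theorem wedge_one (g : G) : wedge q g 1 = 1 := by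
  have e := wedge_mul (q := q) g 1 1
  simpa [conj] using e

theorem wedge_mul_wedge_swap (g h : G) : wedge q g h * wedge q h g = 1 := by
  have key : ∀ a b : G, wedge q (conj a b) (conj b b) * wedge q (conj b b) (conj a b) = 1 := by
    intro a b
    have e₁ : conj b b = b := by simp [conj]
    have e := wedge_self (q := q) (a * b)
    -- Expanding `ab ∧ ab = 1` in both arguments leaves only the two mixed terms.
    rw [mul_wedge, conj_mul, wedge_mul, wedge_self, mul_one, wedge_mul, wedge_self, one_mul] at e
    rwa [e₁] at e ⊢
  simpa only [conj_conj_inv, conj_one, show conj h h = h by simp [conj]] using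
    key (conj g h⁻¹) h

theorem inv_wedge (g h : G) : (wedge q g h)⁻¹ = wedge q h g :=
  inv_eq_of_mul_eq_one_right (wedge_mul_wedge_swap g h)

theorem conj_wedge_wedge (g h g₁ h₁ : G) :
    conj (wedge q g h) (wedge q g₁ h₁) =
      wedge q (conj g (comm g₁ h₁)) (conj h (comm g₁ h₁)) :=
  congrArg (QuotientGroup.mk (s := diagonal q G)) (conj_tmul g h g₁ h₁)

theorem conj_wedge_extHat (hq : 1 ≤ q) (g h k : G) :
    conj (wedge q g h) (extHat hq k) = wedge q (conj g (k ^ q)) (conj h (k ^ q)) :=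
  congrArg (QuotientGroup.mk (s := diagonal q G)) (conj_hat hq g h k)

theorem comm_extHat (hq : 1 ≤ q) (k k₁ : G) :
    comm (extHat hq k) (extHat hq k₁) = wedge q (k ^ q) (k₁ ^ q) :=
  congrArg (QuotientGroup.mk (s := diagonal q G)) (mk_eq_of_rel (TensorRel.comm_hat hq k k₁))

theorem extHat_comm (hq : 1 ≤ q) (g h : G) : extHat hq (comm g h) = wedge q g h ^ q :=
  congrArg (QuotientGroup.mk (s := diagonal q G)) (mk_eq_of_rel (TensorRel.hat_comm hq g h))

theorem extHat_mul (hq : 1 ≤ q) (k k₁ : G) :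
    extHat hq (k * k₁) = extHat hq k *
      ((List.range (q - 1)).map fun j =>
        wedge q (conj k (k ^ (q - 1 - (j + 1))))
          (conj (k₁ ^ (j + 1))⁻¹ (k ^ (q - 1 - (j + 1))))).prod * extHat hq k₁ := by
  have e := congrArg (QuotientGroup.mk' (diagonal q G))
    (mk_eq_of_rel (TensorRel.hat_mul hq k k₁))
  rw [map_mul (PresentedGroup.mk _), map_mul (PresentedGroup.mk _), map_list_prod,
    map_mul, map_mul, map_list_prod, List.map_map, List.map_map] at e
  exact e

/-- The generators already act through their images under `∂`, and this property passes to products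
and inverses. -/
theorem conj_wedge (g h : G) (p : ExteriorSquare q G) :
    conj (wedge q g h) p = wedge q (conj g (boundary q G p)) (conj h (boundary q G p)) := by
  let S : Subgroup (ExteriorSquare q G) :=
    { carrier := {p | ∀ g h : G, conj (wedge q g h) p =
        wedge q (conj g (boundary q G p)) (conj h (boundary q G p))}
      one_mem' := by intro g h; simp [conj_one]
      mul_mem' := by
        intro a b ha hb g h
        rw [← conj_conj, ha, hb, conj_conj, conj_conj, map_mul]
      inv_mem' := by
        intro a ha g h
        rw [map_inv]
        have e := ha (conj g (boundary q G a)⁻¹) (conj h (boundary q G a)⁻¹)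
        rw [conj_conj_inv, conj_conj_inv] at e
        rw [← e, conj_conj, mul_inv_cancel, conj_one] }
  have : p ∈ S := by
    rw [exteriorSquare_closure_eq_top S]
    · trivial
    · intro a b g h
      rw [conj_wedge_wedge, boundary_wedge]
    · intro hq k g h
      rw [conj_wedge_extHat, boundary_extHat]
  exact this g h

/-- The elements `a` of a group `Q` under `G ∧^q G` and over `G` for which `[a, b]` is the image of
`∂a ∧ ∂b`. -/
def commLocus {Q : Type*} [Group Q] (d : Q →* G) (ι : ExteriorSquare q G →* Q)
    (hι : ∀ g h a, conj (ι (wedge q g h)) a = ι (wedge q (conj g (d a)) (conj h (d a)))) (b : Q) :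
    Subgroup Q where
  carrier := {a | comm a b = ι (wedge q (d a) (d b))}
  one_mem' := by simp [comm, one_wedge]
  mul_mem' := by
    intro x y hx hy
    change comm _ _ = _ at hx hy ⊢
    -- In `a`, both sides are crossed homomorphisms, and `hι` matches the two actions.
    rw [comm_mul_left, hx, hy, hι, map_mul, mul_wedge, map_mul]
  inv_mem' := by
    intro x hx
    change comm _ _ = _ at hx ⊢
    have e : comm (x * x⁻¹) b = ι (wedge q (d (x * x⁻¹)) (d b)) := by
      simp [comm, one_wedge]
    rw [comm_mul_left, hx, hι, map_mul, mul_wedge, map_mul] at e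
    exact mul_left_cancel e

theorem mem_commLocus_swap {Q : Type*} [Group Q] (d : Q →* G) (ι : ExteriorSquare q G →* Q)
    (hι : ∀ g h a, conj (ι (wedge q g h)) a = ι (wedge q (conj g (d a)) (conj h (d a))))
    (a b : Q) : a ∈ commLocus d ι hι b ↔ b ∈ commLocus d ι hι a := by
  change comm _ _ = _ ↔ comm _ _ = _
  rw [← comm_inv b a, ← inv_wedge, map_inv, inv_inj]

theorem wedge_mul' (g h h₁ : G) :
    wedge q g (h * h₁) = wedge q g h * wedge q (conj g h) h₁ := by
  rw [show h * h₁ = conj h₁ h⁻¹ * h by simp only [conj]; group, wedge_mul, conj_conj_inv]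

theorem inv_wedge_conj (g y z : G) :
    wedge q (conj g⁻¹ z) (conj y z) = (wedge q (conj g (g⁻¹ * z)) (conj y (g⁻¹ * z)))⁻¹ := by
  have e := mul_wedge (q := q) (conj g z) (conj g⁻¹ z) (conj y z)
  rw [← conj_mul, mul_inv_cancel, one_conj, one_wedge, conj_conj, conj_conj] at e
  have e' : z * conj g⁻¹ z = g⁻¹ * z := by simp only [conj]; group
  rw [e'] at e
  exact eq_inv_of_mul_eq_one_right e.symm

/-- Comes from expanding `g ∧ hy` in two ways, with `[g, h] = g⁻¹ g^h`. It says that `p ↦ p (∂p ∧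
y)` is the diagonal action of `y` on the symbols `g ∧ h`, which makes the later action on extensions
possible. -/
theorem wedge_mul_comm_wedge (g h y : G) :
    wedge q g h * wedge q (comm g h) y = wedge q (conj g y) (conj h y) := by
  have e₁ : comm g h = g⁻¹ * conj g h := by simp only [comm, conj]; group
  have e₃ : wedge q (conj g⁻¹ (conj g h)) (conj y (conj g h)) =
      (conj (wedge q g y) (wedge q g h))⁻¹ := by
    have e : g⁻¹ * conj g h = comm g h := e₁.symm
    have e' := inv_wedge_conj (q := q) g y (conj g h)
    rw [e', conj_wedge_wedge, e]
  have e₄ : wedge q g h * wedge q (conj g h) y = wedge q g y * wedge q (conj g y) (conj h y) := by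
    rw [← wedge_mul, wedge_mul']
  rw [e₁, mul_wedge, e₃, conj, mul_inv_rev, mul_inv_rev, inv_inv]
  rw [← mul_right_inj (wedge q g y), ← e₄]
  group

/-- For `p, p' ∈ G ∧^q G`, `[p, p'] = ∂p ∧ ∂p'`. -/
theorem comm_eq_wedge_boundary (p p' : ExteriorSquare q G) :
    comm p p' = wedge q (boundary q G p) (boundary q G p') := by
  have hL : ∀ p', commLocus (boundary q G) (MonoidHom.id (ExteriorSquare q G)) conj_wedge p' = ⊤ := by
    have hw : ∀ p' g h, wedge q g h ∈
        commLocus (boundary q G) (MonoidHom.id (ExteriorSquare q G)) conj_wedge p' := by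
      intro p' g h
      change comm _ _ = wedge q _ _
      rw [boundary_wedge, ← mul_right_inj (wedge q g h), ← conj_eq_mul_comm, conj_wedge,
        wedge_mul_comm_wedge]
    intro p'
    refine exteriorSquare_closure_eq_top _ (hw p') fun hq k => ?_
    -- The identity is symmetric in the two arguments, so a hat against an arbitrary element reduces
    -- to hats against generators: wedges are covered by `hw`, hats by the relation for `[k̂, k̂₁]`.
    rw [← mem_commLocus_swap]
    revert p'
    suffices h : commLocus (boundary q G) (MonoidHom.id (ExteriorSquare q G)) conj_wedge
        (extHat hq k) = ⊤ by
      intro p'; rw [h]; trivial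
    refine exteriorSquare_closure_eq_top _ (hw _) fun hq' k' => ?_
    change comm _ _ = wedge q _ _
    rw [boundary_extHat, boundary_extHat, comm_extHat]
  have : p ∈ commLocus (boundary q G) (MonoidHom.id (ExteriorSquare q G)) conj_wedge p' := by
    rw [hL]; trivial
  exact this

theorem wedge_eq_one_of_mem_zpowers {g h : G} (hh : h ∈ Subgroup.zpowers g) :
    wedge q g h = 1 := by
  have hc : ∀ k : G, conj k k = k := fun k => by simp [conj]
  have hp : ∀ (k : G) (m : ℕ), wedge q k (k ^ m) = 1 := by
    intro k m
    induction m with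
    | zero => rw [pow_zero, wedge_one]
    | succ m ih =>
      rw [pow_succ, wedge_mul, wedge_self, one_mul, hc,
        show conj (k ^ m) k = k ^ m by rw [conj, mul_assoc, ← pow_succ, pow_succ',
          inv_mul_cancel_left], ih]
  obtain ⟨m, rfl⟩ := hh
  obtain ⟨m, rfl | rfl⟩ := m.eq_nat_or_neg
  · simpa using hp g m
  · have e := wedge_mul (q := q) g (g ^ m) (g ^ m)⁻¹
    have e' : ∀ k : G, k * g = g * k → conj g k = g := fun k hk => by
      rw [conj, mul_assoc, ← hk, inv_mul_cancel_left]
    rw [mul_inv_cancel, wedge_one, e' _ (by group), show conj (g ^ m) (g ^ m)⁻¹ = g ^ m by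
      simp [conj], hp, mul_one] at e
    simpa using e.symm

theorem extHat_pow (hq : 1 ≤ q) (k : G) (m : ℕ) :
    extHat hq (k ^ m) = extHat hq k ^ m := by
  have h1 : extHat hq (1 : G) = 1 := by
    have e := extHat_comm hq (1 : G) 1
    rwa [wedge_self, one_pow, show comm (1 : G) 1 = 1 by simp [comm]] at e
  induction m with
  | zero => rw [pow_zero, pow_zero, h1]
  | succ m ih =>
    rw [pow_succ' k, extHat_mul, ih, pow_succ', List.prod_eq_one, mul_one]
    -- Each factor is a wedge of two powers of `k`, hence trivial.
    intro x hx
    obtain ⟨j, -, rfl⟩ := List.mem_map.mp hx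
    have e : ∀ u i, u ∈ Subgroup.zpowers k → conj u (k ^ i) = u := by
      rintro _ i ⟨z, rfl⟩
      simp only [conj]
      group
    have hk := Subgroup.mem_zpowers k
    rw [e _ _ hk, e _ _ (inv_mem (pow_mem (pow_mem hk _) _))]
    exact wedge_eq_one_of_mem_zpowers (inv_mem (pow_mem (pow_mem hk _) _))

/-- For `p ∈ G ∧^q G`, the element `k̂` with `k = ∂p` is `p ^ q`. -/
theorem extHat_boundary (hq : 1 ≤ q) (p : ExteriorSquare q G) :
    extHat hq (boundary q G p) = p ^ q := by
  -- The hat of `∂p` and `p ^ q` obey the same product formula: `comm_eq_wedge_boundary` turns the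
  -- commutators in the expansion of `(a * b) ^ q` into the wedges of the hat relation. Agreement on
  -- generators then suffices.
  have hm : ∀ a b : ExteriorSquare q G, extHat hq (boundary q G (a * b)) =
      extHat hq (boundary q G a) * (a ^ q)⁻¹ * (a * b) ^ q * (b ^ q)⁻¹ *
        extHat hq (boundary q G b) := by
    intro a b
    rw [mul_pow_eq_prod_comm hq a b, map_mul, extHat_mul]
    have e : ∀ c d : ExteriorSquare q G, ∀ j i, conj (comm c (d ^ j)⁻¹) (c ^ i) =
        wedge q (conj (boundary q G c) (boundary q G c ^ i))
          (conj (boundary q G d ^ j)⁻¹ (boundary q G c ^ i)) := by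
      intro c d j i
      rw [comm_eq_wedge_boundary, conj_wedge, map_inv, map_pow, map_pow]
    simp only [e]
    group
  let S : Subgroup (ExteriorSquare q G) :=
    { carrier := {p | extHat hq (boundary q G p) = p ^ q}
      one_mem' := by
        have e := extHat_pow hq (1 : G) 0
        simpa using e
      mul_mem' := by
        intro a b ha hb
        change extHat hq _ = _ at ha hb ⊢
        rw [hm, ha, hb]
        group
      inv_mem' := by
        intro a ha
        change extHat hq _ = _ at ha ⊢
        have e := hm a⁻¹ a
        have e' := extHat_pow hq (1 : G) 0
        rw [pow_zero, pow_zero] at e'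
        rw [inv_mul_cancel, map_one, e', one_pow, mul_one, ha, mul_assoc, inv_mul_cancel,
          mul_one] at e
        exact eq_of_mul_inv_eq_one e.symm }
  have : p ∈ S := by
    rw [exteriorSquare_closure_eq_top S]
    · trivial
    · intro g h
      change extHat hq _ = _
      rw [boundary_wedge, extHat_comm]
    · intro hq' k
      change extHat hq _ = _
      rw [boundary_extHat, extHat_pow]
  exact this

end wedge

/-! ### Extensions with commutators given by the wedge -/

/-- A group `Q` over `G` into which `G ∧^q G` embeds over `G`, such that the commutators of `Q`
are given by the exterior product and the cokernel is torsion-free. -/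
structure WedgeExtension.{u} (q : ℕ) (G : Type u) [Group G] where
  /-- the underlying group -/
  Q : Type u
  [group : Group Q]
  /-- the projection to `G` -/
  d : Q →* G
  /-- the embedding of `G ∧^q G` -/
  ι : ExteriorSquare q G →* Q
  ι_injective : Function.Injective ι
  d_ι : ∀ p, d (ι p) = boundary q G p
  comm_eq : ∀ a b, comm a b = ι (wedge q (d a) (d b))
  mem_range_of_pow : ∀ (m : ℕ) (a : Q), m ≠ 0 → a ^ m ∈ ι.range → a ∈ ι.range

attribute [instance] WedgeExtension.group

namespace WedgeExtension

universe u

variable {q : ℕ} {G : Type u} [Group G]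

/-- `G ∧^q G` itself. -/
noncomputable def base (q : ℕ) (G : Type u) [Group G] : WedgeExtension q G where
  Q := ExteriorSquare q G
  d := boundary q G
  ι := MonoidHom.id _
  ι_injective := Function.injective_id
  d_ι _ := rfl
  comm_eq := comm_eq_wedge_boundary
  mem_range_of_pow _ a _ _ := ⟨a, rfl⟩

variable (X : WedgeExtension q G)

theorem d_ι_wedge (g h : G) : X.d (X.ι (wedge q g h)) = comm g h := by
  rw [X.d_ι, boundary_wedge]

theorem conj_ι_wedge (g h : G) (a : X.Q) :
    conj (X.ι (wedge q g h)) a = X.ι (wedge q (conj g (X.d a)) (conj h (X.d a))) := by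
  rw [conj_eq_mul_comm, X.comm_eq, X.d_ι_wedge, ← map_mul, wedge_mul_comm_wedge]

/-- The action of `y ∈ G` on `Q`. -/
def act (y : G) : X.Q →* X.Q where
  -- When `y = d b` this is `a [a, b] = a^b`; the formula makes sense even if `y` has no lift to
  -- `Q`.
  toFun a := a * X.ι (wedge q (X.d a) y)
  map_one' := by rw [map_one, one_wedge, map_one, mul_one]
  map_mul' a b := by
    rw [map_mul, mul_wedge, map_mul, ← X.conj_ι_wedge, conj]
    group

theorem act_apply (y : G) (a : X.Q) : X.act y a = a * X.ι (wedge q (X.d a) y) := rfl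

theorem d_act (y : G) (a : X.Q) : X.d (X.act y a) = conj (X.d a) y := by
  rw [act_apply, map_mul, d_ι_wedge, conj_eq_mul_comm]

theorem act_act (y z : G) (a : X.Q) : X.act z (X.act y a) = X.act (y * z) a := by
  rw [act_apply, d_act, act_apply, act_apply, wedge_mul', map_mul, mul_assoc]

theorem act_one (a : X.Q) : X.act 1 a = a := by
  rw [act_apply, wedge_one, map_one, mul_one]

/-- The action of `y ∈ G` on `Q` as an automorphism. -/
def actEquiv (y : G) : MulAut X.Q :=
  MonoidHom.toMulEquiv (X.act y) (X.act y⁻¹)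
    (by ext a; simp [act_act, act_one]) (by ext a; simp [act_act, act_one])

/-- The action of `ℤ` on `Q` through the powers of `x`. -/
def zact (x : G) : Multiplicative ℤ →* MulAut X.Q := zpowersHom _ (X.actEquiv x)

theorem d_zact (x : G) (n : Multiplicative ℤ) (a : X.Q) :
    X.d (X.zact x n a) = zpowersHom G x⁻¹ n * X.d a * (zpowersHom G x⁻¹ n)⁻¹ := by
  induction n using Multiplicative.rec with | _ n
  simp only [zact, zpowersHom_apply, toAdd_ofAdd]
  have h1 : ∀ a, X.d (X.actEquiv x a) = x⁻¹ * X.d a * x := X.d_act x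
  have h2 : ∀ a, X.d ((X.actEquiv x)⁻¹ a) = x * X.d a * x⁻¹ := fun a => by
    rw [← MulAut.apply_inv_self _ (X.actEquiv x) a, h1]
    simp
    group
  induction n using Int.induction_on generalizing a with
  | zero => simp
  | succ n ih => rw [zpow_add_one, MulAut.mul_apply, ih, h1]; group
  | pred n ih => rw [zpow_sub_one, MulAut.mul_apply, ih, h2]; group

/-- The group obtained from `Q` by adjoining a generator `t` over `x⁻¹`. -/
abbrev AdjoinGroup (x : G) : Type u := X.Q ⋊[X.zact x] Multiplicative ℤ

/-- The projection of the extended group to `G`. -/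
def adjoinD (x : G) : X.AdjoinGroup x →* G :=
  SemidirectProduct.lift X.d (zpowersHom G x⁻¹) fun n => MonoidHom.ext fun a => X.d_zact x n a

/-- The embedding of `G ∧^q G` into the extended group. -/
def adjoinι (x : G) : ExteriorSquare q G →* X.AdjoinGroup x := SemidirectProduct.inl.comp X.ι

/-- The adjoined element over `x`. -/
def adjoined (x : G) : X.AdjoinGroup x := (SemidirectProduct.inr (Multiplicative.ofAdd 1))⁻¹

theorem adjoinD_adjoined (x : G) : X.adjoinD x (X.adjoined x) = x := by
  simp [adjoinD, adjoined]

theorem adjoinD_inl (x : G) (a : X.Q) : X.adjoinD x (SemidirectProduct.inl a) = X.d a := by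
  simp [adjoinD]

theorem conj_adjoined (x : G) (a : X.Q) :
    conj (SemidirectProduct.inl a) (X.adjoined x) =
      (SemidirectProduct.inl (X.act x a) : X.AdjoinGroup x) := by
  -- The semidirect product realises the action as `t a t⁻¹`, while `conj` conjugates from the
  -- right; hence the lift of `x` is `t⁻¹`.
  have e := SemidirectProduct.inl_aut (φ := X.zact x) (Multiplicative.ofAdd 1) a
  rw [conj, adjoined, inv_inv, ← map_inv, ← e]
  simp only [zact, zpowersHom_apply, toAdd_ofAdd, zpow_one]
  rfl

theorem adjoin_closure_eq_top (x : G) (S : Subgroup (X.AdjoinGroup x))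
    (hl : ∀ a, SemidirectProduct.inl a ∈ S) (ht : X.adjoined x ∈ S) : S = ⊤ := by
  rw [eq_top_iff]
  intro a _
  rw [← SemidirectProduct.inl_left_mul_inr_right a]
  refine mul_mem (hl _) ?_
  have e : SemidirectProduct.inr a.right = ((X.adjoined x)⁻¹) ^ (Multiplicative.toAdd a.right) := by
    rw [adjoined, inv_inv, ← map_zpow, ← ofAdd_zsmul, smul_eq_mul, mul_one, ofAdd_toAdd]
  rw [e]
  exact zpow_mem (inv_mem ht) _

theorem conj_adjoinι_wedge (x g h : G) (a : X.AdjoinGroup x) :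
    conj (X.adjoinι x (wedge q g h)) a =
      X.adjoinι x (wedge q (conj g (X.adjoinD x a)) (conj h (X.adjoinD x a))) := by
  let S : Subgroup (X.AdjoinGroup x) :=
    { carrier := {a | ∀ g h, conj (X.adjoinι x (wedge q g h)) a =
        X.adjoinι x (wedge q (conj g (X.adjoinD x a)) (conj h (X.adjoinD x a)))}
      one_mem' := by intro g h; simp [conj_one]
      mul_mem' := by
        intro a b ha hb g h
        rw [← conj_conj, ha, hb, conj_conj, conj_conj, map_mul]
      inv_mem' := by
        intro a ha g h
        rw [map_inv]
        have e := ha (conj g (X.adjoinD x a)⁻¹) (conj h (X.adjoinD x a)⁻¹)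
        rw [conj_conj_inv, conj_conj_inv] at e
        rw [← e, conj_conj, mul_inv_cancel, conj_one] }
  have : a ∈ S := by
    rw [X.adjoin_closure_eq_top x S]
    · trivial
    · intro b g h
      rw [adjoinD_inl, adjoinι, MonoidHom.comp_apply, ← map_conj, conj_ι_wedge]
      rfl
    · intro g h
      rw [adjoinD_adjoined, adjoinι, MonoidHom.comp_apply, conj_adjoined, act_apply, d_ι_wedge,
        ← map_mul, wedge_mul_comm_wedge]
      rfl
  exact this g h

/-- Reduces to pairs of generators: two elements of `Q` are covered by `X`, an element of `Q` and
the adjoined one by the definition of the action, and the adjoined one with itself by `x ∧ x = 1`.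
-/
theorem comm_adjoin (x : G) (a b : X.AdjoinGroup x) :
    comm a b = X.adjoinι x (wedge q (X.adjoinD x a) (X.adjoinD x b)) := by
  have ht : ∀ c : X.Q, SemidirectProduct.inl c ∈
      commLocus (X.adjoinD x) (X.adjoinι x) (X.conj_adjoinι_wedge x) (X.adjoined x) := by
    intro c
    change comm _ _ = _
    rw [← mul_right_inj (SemidirectProduct.inl c : X.AdjoinGroup x), ← conj_eq_mul_comm,
      conj_adjoined, adjoinD_inl, adjoinD_adjoined, act_apply, map_mul]
    rfl
  have h : ∀ c, commLocus (X.adjoinD x) (X.adjoinι x) (X.conj_adjoinι_wedge x) c = ⊤ := by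
    have h₁ : commLocus (X.adjoinD x) (X.adjoinι x) (X.conj_adjoinι_wedge x) (X.adjoined x) = ⊤ :=
      X.adjoin_closure_eq_top x _ ht (by
        change comm _ _ = _
        rw [wedge_self, map_one]
        exact (comm_eq_one_iff _ _).mpr rfl)
    have h₂ : ∀ c : X.Q, commLocus (X.adjoinD x) (X.adjoinι x) (X.conj_adjoinι_wedge x)
        (SemidirectProduct.inl c) = ⊤ := fun c =>
      X.adjoin_closure_eq_top x _ (fun b => by
        change comm _ _ = _
        rw [← map_comm, X.comm_eq, adjoinD_inl, adjoinD_inl]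
        rfl) ((mem_commLocus_swap _ _ _ _ _).mp (ht c))
    intro c
    refine X.adjoin_closure_eq_top x _ (fun b => ?_) ?_
    · rw [mem_commLocus_swap, h₂]; trivial
    · rw [mem_commLocus_swap, h₁]; trivial
  have : a ∈ commLocus (X.adjoinD x) (X.adjoinι x) (X.conj_adjoinι_wedge x) b := by
    rw [h]; trivial
  exact this

/-- The extension obtained from `X` by adjoining a generator over `x`. -/
def adjoin (x : G) : WedgeExtension q G where
  Q := X.AdjoinGroup x
  d := X.adjoinD x
  ι := X.adjoinι x
  ι_injective := SemidirectProduct.inl_injective.comp X.ι_injective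
  d_ι p := (X.adjoinD_inl x _).trans (X.d_ι p)
  comm_eq := X.comm_adjoin x
  mem_range_of_pow m a hm := by
    rintro ⟨p, hp⟩
    -- The new factor `ℤ` is torsion-free, so `a` lies in `Q`, where the hypothesis on `X` applies.
    have hr : a.right ^ m = 1 := by
      have := congrArg SemidirectProduct.rightHom hp
      rw [map_pow, adjoinι, MonoidHom.comp_apply, SemidirectProduct.rightHom_inl] at this
      exact this.symm
    have hr' : a.right = 1 := (pow_eq_one_iff_left hm).mp hr
    have ha : SemidirectProduct.inl a.left = a := by
      conv_rhs => rw [← SemidirectProduct.inl_left_mul_inr_right a, hr', map_one, mul_one]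
    obtain ⟨p', hp'⟩ := X.mem_range_of_pow m a.left hm
      ⟨p, SemidirectProduct.inl_injective (φ := X.zact x) (by rw [map_pow, ha]; exact hp)⟩
    exact ⟨p', by rw [adjoinι, MonoidHom.comp_apply, hp', ha]⟩

/-- Finitely many elements of `G` can be lifted to a suitable extension. -/
theorem exists_forall_mem_range (l : List G) :
    ∃ X : WedgeExtension q G, ∀ x ∈ l, x ∈ X.d.range := by
  induction l with
  | nil => exact ⟨base q G, by simp⟩
  | cons x l ih =>
    obtain ⟨X, hX⟩ := ih
    refine ⟨X.adjoin x, fun y hy => ?_⟩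
    rcases List.mem_cons.mp hy with rfl | hy
    · exact ⟨X.adjoined y, X.adjoinD_adjoined y⟩
    · obtain ⟨a, ha⟩ := hX y hy
      exact ⟨SemidirectProduct.inl a, (X.adjoinD_inl x a).trans ha⟩

end WedgeExtension

/-! ### The exterior centre and capability -/

section main

universe u

variable {q n : ℕ} {G : Type u} [Group G]

theorem E.proj_surjective {φ : FreeGroup (Fin n) →* G} (hφ : Function.Surjective φ) :
    Function.Surjective (E.proj φ q) :=
  QuotientGroup.lift_surjective_of_surjective _ _ hφ _

theorem E.ker_proj_le (φ : FreeGroup (Fin n) →* G) : (E.proj φ q).ker ≤ qCenter q (E φ q) := by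
  intro z hz
  obtain ⟨r, rfl⟩ := QuotientGroup.mk'_surjective _ z
  have hr : r ∈ φ.ker := hz
  refine ⟨Subgroup.mem_center_iff.mpr fun y => ?_, ?_⟩
  · obtain ⟨f, rfl⟩ := QuotientGroup.mk'_surjective _ y
    rw [← commutatorElement_eq_one_iff_mul_comm, ← map_commutatorElement]
    exact (QuotientGroup.eq_one_iff _).mpr
      (Subgroup.mem_sup_right (Subgroup.commutator_mem_commutator trivial hr))
  · rw [← map_pow]
    exact (QuotientGroup.eq_one_iff _).mpr
      (Subgroup.mem_sup_left (Subgroup.subset_closure ⟨r, hr, rfl⟩))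

/-- If `s : F → Q` maps the kernel of `φ` into the centre of `Q`, then it maps the elements of
`R^q [F, R]` to `q`-th powers of elements of `s(R)`. -/
theorem exists_pow_of_mem_relSubgroup {F Q : Type*} [Group F] [Group Q] {φ : F →* G}
    {s : F →* Q} (hs : φ.ker.map s ≤ Subgroup.center Q) {v : F} (hv : v ∈ relSubgroup φ q) :
    ∃ r ∈ φ.ker, s v = s r ^ q := by
  have hz : ∀ r ∈ φ.ker, s r ∈ Subgroup.center Q := fun r hr => hs ⟨r, hr, rfl⟩
  -- As `s(R)` is central, `q`-th powers of its elements are closed under products and inverses;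
  -- commutators in `[F, R]` die, so `r = 1` serves for them.
  let S : Subgroup F :=
    { carrier := {v | ∃ r ∈ φ.ker, s v = s r ^ q}
      one_mem' := ⟨1, one_mem _, by simp⟩
      mul_mem' := by
        rintro a b ⟨r, hr, ha⟩ ⟨t, ht, hb⟩
        have : Commute (s r) (s t) := Subgroup.mem_center_iff.mp (hz t ht) _
        exact ⟨r * t, mul_mem hr ht, by rw [map_mul, map_mul, ha, hb, this.mul_pow]⟩
      inv_mem' := by
        rintro a ⟨r, hr, ha⟩
        exact ⟨r⁻¹, inv_mem hr, by rw [map_inv, map_inv, ha, inv_pow]⟩ }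
  have hS : relSubgroup φ q ≤ S := by
    refine sup_le ((Subgroup.closure_le _).mpr ?_) (Subgroup.commutator_le.mpr ?_)
    · rintro _ ⟨r, hr, rfl⟩
      exact ⟨r, hr, map_pow s r q⟩
    · intro f _ r hr
      refine ⟨1, one_mem _, ?_⟩
      rw [map_commutatorElement, map_one, one_pow, commutatorElement_eq_one_iff_mul_comm]
      exact Subgroup.mem_center_iff.mp (hz r hr) _
  exact hS hv

theorem wedge_eq_one_of_comm_mem {φ : FreeGroup (Fin n) →* G}
    {a b : FreeGroup (Fin n)} (h : comm a b ∈ relSubgroup φ q) : wedge q (φ a) (φ b) = 1 := by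
  obtain ⟨X, hX⟩ := WedgeExtension.exists_forall_mem_range (q := q)
    (List.ofFn fun i => φ (FreeGroup.of i))
  have hX' : ∀ i, ∃ t, X.d t = φ (FreeGroup.of i) := fun i => hX _ (by simp)
  choose t ht using hX'
  let s : FreeGroup (Fin n) →* X.Q := FreeGroup.lift t
  have hs : ∀ a, X.d (s a) = φ a := by
    have : X.d.comp s = φ := by ext i; simp [s, ht]
    exact DFunLike.congr_fun this
  have hc : ∀ c, X.d c = 1 → c ∈ Subgroup.center X.Q := fun c hc =>
    Subgroup.mem_center_iff.mpr fun y => ((comm_eq_one_iff c y).mp (by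
      rw [X.comm_eq, hc, one_wedge, map_one])).symm
  obtain ⟨r, hr, e⟩ := exists_pow_of_mem_relSubgroup (q := q) (φ := φ) (s := s) (by
    rintro _ ⟨r, hr, rfl⟩
    exact hc _ ((hs r).trans hr)) h
  rw [map_comm, X.comm_eq, hs, hs] at e
  apply X.ι_injective
  -- For `q = 0` the power is already trivial; root extraction and hats need `q ≥ 1`.
  rcases Nat.eq_zero_or_pos q with rfl | hq
  · rw [e, pow_zero, map_one]
  · obtain ⟨p, hp⟩ := X.mem_range_of_pow q (s r) hq.ne' ⟨_, e⟩
    have hp' : boundary q G p = 1 := by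
      rw [← X.d_ι, hp, hs]; exact hr
    have e' := extHat_boundary hq p
    have h1 := extHat_boundary (G := G) hq 1
    rw [map_one, one_pow] at h1
    rw [hp', h1] at e'
    rw [e, ← hp, ← map_pow, ← e']

theorem exteriorCenter_eq {φ : FreeGroup (Fin n) →* G} (hφ : Function.Surjective φ) :
    exteriorCenter q G = (Subgroup.center (E φ q)).map (E.proj φ q) := by
  ext g
  constructor
  · intro hg
    obtain ⟨a, rfl⟩ := E.proj_surjective (q := q) hφ g
    obtain ⟨Ψ, hΨ, -⟩ := exists_lift (E.proj φ q) (E.proj_surjective hφ) (E.ker_proj_le φ)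
    refine ⟨a, Subgroup.mem_center_iff.mpr fun b => ?_, rfl⟩
    have e := hΨ a b
    rw [hg (E.proj φ q b), map_one] at e
    exact ((comm_eq_one_iff a b).mp e.symm).symm
  · rintro ⟨a, ha, rfl⟩ x
    obtain ⟨b, rfl⟩ := hφ x
    obtain ⟨a, rfl⟩ := QuotientGroup.mk'_surjective _ a
    refine wedge_eq_one_of_comm_mem ((QuotientGroup.eq_one_iff _).mp ?_)
    have e := (comm_eq_one_iff _ _).mpr
      (Subgroup.mem_center_iff.mp ha (QuotientGroup.mk' _ b)).symm
    rwa [← map_comm] at e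

theorem isQCapable_iff {φ : FreeGroup (Fin n) →* G} (hφ : Function.Surjective φ) :
    IsQCapable q G ↔ (Subgroup.center (E φ q)).map (E.proj φ q) = ⊥ := by
  constructor
  · rintro ⟨Q, _, hQ, ⟨e⟩⟩
    have hex : ∀ i, ∃ t : Q, (QuotientGroup.mk t : Q ⧸ Subgroup.center Q) =
        e (φ (FreeGroup.of i)) := fun i => QuotientGroup.mk_surjective _
    choose t ht using hex
    let s : FreeGroup (Fin n) →* Q := FreeGroup.lift t
    have hs : ∀ a, (QuotientGroup.mk (s a) : Q ⧸ Subgroup.center Q) = e (φ a) := by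
      have : (QuotientGroup.mk' (Subgroup.center Q)).comp s = e.toMonoidHom.comp φ := by
        ext i; simp [s, ht]
      exact DFunLike.congr_fun this
    have hs' : ∀ a, s a ∈ Subgroup.center Q ↔ φ a = 1 := fun a => by
      rw [← QuotientGroup.eq_one_iff, hs, map_eq_one_iff e e.injective]
    have hker : ∀ v ∈ relSubgroup φ q, s v = 1 := by
      intro v hv
      obtain ⟨r, hr, h⟩ := exists_pow_of_mem_relSubgroup (s := s) (by
        rintro _ ⟨r, hr, rfl⟩
        exact (hs' r).mpr hr) hv
      have : s r ∈ qCenter q Q := hQ ▸ (hs' r).mpr hr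
      rw [h, this.2]
    rw [eq_bot_iff]
    rintro _ ⟨a, ha, rfl⟩
    obtain ⟨a, rfl⟩ := QuotientGroup.mk'_surjective _ a
    refine (hs' a).mp (Subgroup.mem_center_iff.mpr fun y => ?_)
    obtain ⟨b, hb⟩ := hφ (e.symm y)
    -- The image of `s` together with `Z(Q)` is all of `Q`, so commuting with each `s b` is enough
    -- to be central.
    obtain ⟨z, hz, rfl⟩ : ∃ z ∈ Subgroup.center Q, y = s b * z := by
      refine ⟨(s b)⁻¹ * y, QuotientGroup.eq.mp ?_, by group⟩
      rw [hs, hb, MulEquiv.apply_symm_apply]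
    have hab : comm a b ∈ relSubgroup φ q := by
      refine (QuotientGroup.eq_one_iff _).mp ?_
      have h := (comm_eq_one_iff _ _).mpr
        (Subgroup.mem_center_iff.mp ha (QuotientGroup.mk' _ b)).symm
      rwa [← map_comm] at h
    have h := hker _ hab
    rw [map_comm, comm_eq_one_iff] at h
    rw [← mul_assoc, h, mul_assoc, mul_assoc, Subgroup.mem_center_iff.mp hz]
  · intro h
    have hker : (E.proj φ q).ker = Subgroup.center (E φ q) :=
      le_antisymm (fun z hz => (E.ker_proj_le φ hz).1) ((Subgroup.map_eq_bot_iff _).mp h)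
    -- `E φ q` lives in the lowest universe, whereas a witness must live in that of `G`.
    let u : ULift.{u} (E φ q) ≃* E φ q := MulEquiv.ulift
    let f : ULift.{u} (E φ q) →* G := (E.proj φ q).comp u.toMonoidHom
    have hf : f.ker = Subgroup.center (ULift.{u} (E φ q)) := by
      ext z
      rw [MonoidHom.mem_ker, show f z = E.proj φ q (u z) from rfl, ← MonoidHom.mem_ker, hker,
        Subgroup.mem_center_iff, Subgroup.mem_center_iff]
      constructor
      · intro hz y
        exact u.injective (by rw [map_mul, map_mul, hz])
      · intro hz y
        have := congrArg u (hz (u.symm y))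
        simpa using this
    have hpow : ∀ z ∈ Subgroup.center (ULift.{u} (E φ q)), z ^ q = 1 := by
      intro z hz
      rw [← hf] at hz
      exact u.injective (by rw [map_pow, map_one]; exact (E.ker_proj_le φ hz).2)
    exact ⟨ULift.{u} (E φ q), inferInstance,
      le_antisymm (fun z hz => ⟨hz, hpow z hz⟩) (fun z hz => hz.1),
      ⟨((QuotientGroup.quotientMulEquivOfEq hf.symm).trans
        (QuotientGroup.quotientKerEquivOfSurjective f
          ((E.proj_surjective hφ).comp u.surjective))).symm⟩⟩

end main

end QExterior

theorem mainTheorem1 {G : Type*} [Group G] (hG : QExterior.IsPolycyclic G) (q : ℕ) (n : ℕ)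
    (φ : FreeGroup (Fin n) →* G) (hφ : Function.Surjective φ) :
    QExterior.exteriorCenter q G =
        (Subgroup.center (QExterior.E φ q)).map (QExterior.E.proj φ q) ∧
      (QExterior.IsQCapable q G ↔
        (Subgroup.center (QExterior.E φ q)).map (QExterior.E.proj φ q) = ⊥) :=
  ⟨QExterior.exteriorCenter_eq hφ, QExterior.isQCapable_iff hφ⟩
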